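/- **Conventions.** Let $E$ be a finite set and $\langle\cdot,\cdot\rangle$ the standard inner product on $\mathbb R^E$. A *point configuration* in $\mathbb R^E$ is a map $\mathbf a:\mathcal A\to\mathbb R^E$, $i\mapsto\mathbf a_i$, from a finite label set $\mathcal A$ (several labels may have the same point); it is assumed to be integral ($\mathbf a_i\in\mathbb Z^E$ for all $i$) and homogeneous (there is $d\in\mathbb Z$ with $\sum_{e\in E}(\mathbf a_i)_e=d$ for all $i$). A *subconfiguration* is given by a subset $\mathcal F\subseteq\mathcal A$, and $\operatorname{Conv}(\mathcal F)$ is the convex hull of $\{\mathbf a_i: i\in\mathcal F\}$. A *face* of $\mathcal F$ is a subconfiguration of the form $\{i\in\mathcal F:\langle\mathbf u,\mathbf a_i\rangle\le\langle\mathbf u,\mathbf a_j\rangle\text{ for all }j\in\mathcal F\}$ with $\mathbf u\in\mathbb R^E$. A collection $\Delta$ of subconfigurations of $\mathcal A$ is a *subdivision* of $\mathcal A$ if (1) every face of a member of $\Delta$ is in $\Delta$; (2) $\bigcup_{\mathcal F\in\Delta}\operatorname{Conv}(\mathcal F)=\operatorname{Conv}(\mathcal A)$; and (3) for any two distinct $\mathcal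 F_1,\mathcal F_2\in\Delta$, the intersection $\operatorname{Conv}(\mathcal F_1)\cap\operatorname{Conv}(\mathcal F_2)$ is a (possibly empty) face of both polytopes $\operatorname{Conv}(\mathcal F_1)$, $\operatorname{Conv}(\mathcal F_2)$, and a proper face of at least one of them. A *weight* on $\mathcal A$ is a function $w:\mathcal A\to\mathbb R$; it induces the *coherent subdivision* $\Delta_w=\{\Delta_w^{\mathbf u}:\mathbf u\in\mathbb R^E\}$ of $\mathcal A$, where $$\Delta_w^{\mathbf u}=\{i\in\mathcal A:\ \langle\mathbf u,\mathbf a_i\rangle+w(i)\le\langle\mathbf u,\mathbf a_j\rangle+w(j)\ \text{ for all } j\in\mathcal A\}.$$ The *Minkowski sum* $\sum_{i=1}^k\mathcal A_i$ of point configurations $(\mathcal A_i,\mathbf a_i)$ in $\mathbb R^E$ is the configuration with label set $\mathcal A_1\times\cdots\times\mathcal A_k$ and points $(j_1,\dots,j_k)\mapsto\sum_i(\mathbf a_i)_{j_i}$. The Minkowski sum of subconfigurations $\mathcal F_i\subseteq\mathcal A_i$ is the subconfiguration with label set $\mathcal F_1\times\cdots\times\mathcal F_k$, and the Minkowski sum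 of weights $w_i$ on $\mathcal A_i$ is the weight $(j_1,\dots,j_k)\mapsto\sum_i w_i(j_i)$. A subdivision $\Delta$ of $\sum_i\mathcal A_i$ is *mixed* if there are subdivisions $\Delta_i$ of $\mathcal A_i$ ($1\le i\le k$) such that every member of $\Delta$ is a Minkowski sum $\sum_i\mathcal F_i$ with $\mathcal F_i\in\Delta_i$ for all $i$. **Theorem.** Let $\mathcal A=\sum_{i=1}^k\mathcal A_i$ be a Minkowski sum of point configurations in $\mathbb R^E$. Assume that for each $i$, if $\dim\operatorname{Conv}(\mathcal A_i)=1$ then $|\mathcal A_i|=2$. Let $w:\mathcal A\to\mathbb R$ be a weight whose coherent subdivision $\Delta_w$ is mixed. Then there exist weights $w_1,\dots,w_k$ on $\mathcal A_1,\dots,\mathcal A_k$ such that $\Delta_{\sum_{i=1}^k w_i}=\Delta_w$. -/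

import Mathlib

/-! A point configuration in `ℝ^E` is a map `a : A → E → ℝ` from a finite label type `A`; several
labels may be sent to the same point. A subconfiguration is the restriction of `a` to a set
`F : Set A` of labels, and a weight is a function `w : A → ℝ`. -/

namespace PointConfiguration

/-- All points of the configuration are lattice points. -/
def Integral {A E : Type*} (a : A → E → ℝ) : Prop :=
  ∀ i e, ∃ z : ℤ, a i e = (z : ℝ)

/-- All points of the configuration have the same integral coordinate sum. -/
def Homogeneous {A E : Type*} [Fintype E] (a : A → E → ℝ) : Prop :=
  ∃ d : ℤ, ∀ i, ∑ e, a i e = (d : ℝ)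

/-- The polytope `Conv(F)` of the subconfiguration with label set `F`. -/
def conv {A E : Type*} (a : A → E → ℝ) (F : Set A) : Set (E → ℝ) :=
  convexHull ℝ (a '' F)

/-- The dimension of the polytope `Conv(A)` of the whole configuration. -/
noncomputable def dim {A E : Type*} (a : A → E → ℝ) : ℕ :=
  Module.finrank ℝ (vectorSpan ℝ (conv a Set.univ))

/-- The face `F^u` of the subconfiguration `F`: the labels in `F` that minimize `⟨u, a_i⟩`. -/
def face {A E : Type*} [Fintype E] (a : A → E → ℝ) (F : Set A) (u : E → ℝ) : Set A :=
  {i | i ∈ F ∧ ∀ j ∈ F, u ⬝ᵥ a i ≤ u ⬝ᵥ a j}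

/-- A collection `Δ` of subconfigurations is a subdivision of the configuration `a`: it is closed
under taking faces, its polytopes cover `Conv(A)`, and the polytopes of two distinct members
intersect in a (possibly empty) face of both that is a proper face of at least one of them.
(It cannot be proper in both when one of the two members is a face of the other.) -/
structure IsSubdivision {A E : Type*} [Fintype E] (a : A → E → ℝ) (Δ : Set (Set A)) : Prop where
  face_mem : ∀ F ∈ Δ, ∀ u : E → ℝ, face a F u ∈ Δ
  iUnion_conv : ⋃ F ∈ Δ, conv a F = conv a Set.univ
  inter_isExposed : ∀ F₁ ∈ Δ, ∀ F₂ ∈ Δ, F₁ ≠ F₂ →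
    IsExposed ℝ (conv a F₁) (conv a F₁ ∩ conv a F₂) ∧
    IsExposed ℝ (conv a F₂) (conv a F₁ ∩ conv a F₂)
  inter_proper : ∀ F₁ ∈ Δ, ∀ F₂ ∈ Δ, F₁ ≠ F₂ →
    conv a F₁ ∩ conv a F₂ ≠ conv a F₁ ∨ conv a F₁ ∩ conv a F₂ ≠ conv a F₂

/-- The face `Δ_w^u` of the coherent subdivision: the labels that minimize `⟨u, a_i⟩ + w(i)`. -/
def coherentFace {A E : Type*} [Fintype E] (a : A → E → ℝ) (w : A → ℝ) (u : E → ℝ) : Set A :=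
  {i | ∀ j, u ⬝ᵥ a i + w i ≤ u ⬝ᵥ a j + w j}

/-- The coherent subdivision `Δ_w` induced by the weight `w`. -/
def coherentSubdivision {A E : Type*} [Fintype E] (a : A → E → ℝ) (w : A → ℝ) : Set (Set A) :=
  Set.range (coherentFace a w)

/-- The Minkowski sum of point configurations, labelled by the product of the label sets. -/
def minkowskiSum {k : ℕ} {A : Fin k → Type*} {E : Type*} (a : ∀ i, A i → E → ℝ) :
    (∀ i, A i) → E → ℝ :=
  fun j => ∑ i, a i (j i)

/-- The Minkowski sum of weights. -/
def weightSum {k : ℕ} {A : Fin k → Type*} (w : ∀ i, A i → ℝ) : (∀ i, A i) → ℝ :=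
  fun j => ∑ i, w i (j i)

/-- A collection `Δ` of subconfigurations of a Minkowski sum is mixed: there are subdivisions `Δ_i`
of the summands such that each member of `Δ` is a Minkowski sum of faces of the `Δ_i` (its label
set is the product of theirs). -/
def IsMixed {k : ℕ} {A : Fin k → Type*} {E : Type*} [Fintype E] (a : ∀ i, A i → E → ℝ)
    (Δ : Set (Set (∀ i, A i))) : Prop :=
  ∃ D : ∀ i, Set (Set (A i)), (∀ i, IsSubdivision (a i) (D i)) ∧
    ∀ F ∈ Δ, ∃ G : ∀ i, Set (A i), (∀ i, G i ∈ D i) ∧ F = Set.pi Set.univ G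

end PointConfiguration

namespace PointConfiguration

open Set Filter Topology MeasureTheory

variable {A E : Type*} [Fintype E]

/-! Each cell of `Δ_w` is a product of sets `G_i(u)`. Moving from `p` to a nearby `q` replaces a
cell by its face in direction `q - p`; faces of products are products of faces, and a nonempty
product determines its factors, so every `G_i` obeys the same local rule (`IsLocallyFace`). It
remains to show that a map `F` with this rule comes from a weight (`exists_eq_coherentFace`).

If `F` came from `w`, then `h(u) = min_j (⟨u, a_j⟩ + w(j))` would be concave and piecewise linear,
with directional slopes `minSlope a (F u)`. Conversely, integrating these slopes along segments from
`0` defines `h`; `slopeIntegral_add` makes it independent of the path. By `slopeIntegral_le_of_mem`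
and `mem_of_le_slopeIntegral`, for a label `j` that occurs in some `F x`, the function `u ↦ h(u) -
⟨u, a_j⟩` is maximal exactly where `j ∈ F u`, and this maximum is `w(j)`. Labels that never occur
get a large weight. -/

/-! ### Local behaviour of faces. -/

/-- Near `p`, the labels in `S` minimizing `⟨q, a_i⟩ + w(i)` form a face of those doing so at `p`. -/
theorem eventually_minimizers_eq_face [Finite A] (a : A → E → ℝ) (w : A → ℝ) (S : Set A)
    (p : E → ℝ) :
    ∀ᶠ q in 𝓝 p, {i | i ∈ S ∧ ∀ j ∈ S, q ⬝ᵥ a i + w i ≤ q ⬝ᵥ a j + w j} =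
      face a {i | i ∈ S ∧ ∀ j ∈ S, p ⬝ᵥ a i + w i ≤ p ⬝ᵥ a j + w j} (q - p) := by
  have hcont : ∀ i, Continuous fun q : E → ℝ => q ⬝ᵥ a i + w i := fun i => by
    unfold dotProduct; fun_prop
  -- Finitely many strict inequalities at `p` persist nearby, so only ties at `p` are left to break.
  have key : ∀ᶠ q in 𝓝 p, ∀ i j, p ⬝ᵥ a i + w i < p ⬝ᵥ a j + w j →
      q ⬝ᵥ a i + w i < q ⬝ᵥ a j + w j := by
    refine eventually_all.2 fun i => eventually_all.2 fun j => ?_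
    by_cases h : p ⬝ᵥ a i + w i < p ⬝ᵥ a j + w j
    · filter_upwards [(hcont i).continuousAt.eventually_lt (hcont j).continuousAt h] with q hq _
        using hq
    · exact Eventually.of_forall fun q h' => absurd h' h
  filter_upwards [key] with q hq
  ext i
  simp only [face, mem_ofPred_eq, sub_dotProduct]
  constructor
  · rintro ⟨hi, hmin⟩
    have hp : ∀ j ∈ S, p ⬝ᵥ a i + w i ≤ p ⬝ᵥ a j + w j := fun j hj => by
      by_contra! h
      exact absurd (hmin j hj) (not_le.2 (hq _ _ h))
    refine ⟨⟨hi, hp⟩, fun j hj => ?_⟩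
    have h1 := hmin j hj.1
    have h2 := hj.2 i hi
    linarith
  · rintro ⟨⟨hi, hp⟩, hmin⟩
    refine ⟨hi, fun j hj => ?_⟩
    rcases (hp j hj).lt_or_eq with h | h
    · exact (hq _ _ h).le
    · have := hmin j ⟨hj, fun l hl => h ▸ hp l hl⟩
      linarith

theorem eventually_coherentFace_eq_face [Finite A] (a : A → E → ℝ) (w : A → ℝ) (p : E → ℝ) :
    ∀ᶠ q in 𝓝 p, coherentFace a w q = face a (coherentFace a w p) (q - p) := by
  simpa [coherentFace] using eventually_minimizers_eq_face a w univ p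

theorem eventually_face_eq_face [Finite A] (a : A → E → ℝ) (S : Set A) (p : E → ℝ) :
    ∀ᶠ q in 𝓝 p, face a S q = face a (face a S p) (q - p) := by
  simpa [face] using eventually_minimizers_eq_face a 0 S p

theorem coherentFace_nonempty [Finite A] [Nonempty A] (a : A → E → ℝ) (w : A → ℝ) (u : E → ℝ) :
    (coherentFace a w u).Nonempty :=
  Finite.exists_min fun i => u ⬝ᵥ a i + w i

theorem face_nonempty [Finite A] (a : A → E → ℝ) {S : Set A} (hS : S.Nonempty) (u : E → ℝ) :
    (face a S u).Nonempty :=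
  S.exists_min_image (fun i => u ⬝ᵥ a i) S.toFinite hS

theorem face_subset (a : A → E → ℝ) (S : Set A) (u : E → ℝ) : face a S u ⊆ S := fun _ h => h.1

/-! ### Slopes of subconfigurations. -/

/-- The least value of the linear form `v` on the points of the subconfiguration `S`. -/
noncomputable def minSlope (a : A → E → ℝ) (S : Set A) (v : E → ℝ) : ℝ :=
  sInf ((fun i => v ⬝ᵥ a i) '' S)

theorem minSlope_eq_of_mem_face {a : A → E → ℝ} {S : Set A} {v : E → ℝ} {i : A}
    (hi : i ∈ face a S v) : minSlope a S v = v ⬝ᵥ a i :=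
  IsLeast.csInf_eq ⟨⟨i, hi.1, rfl⟩, by rintro _ ⟨j, hj, rfl⟩; exact hi.2 j hj⟩

theorem minSlope_le [Finite A] {a : A → E → ℝ} {S : Set A} {v : E → ℝ} {i : A} (hi : i ∈ S) :
    minSlope a S v ≤ v ⬝ᵥ a i := by
  obtain ⟨j, hj⟩ := face_nonempty a ⟨i, hi⟩ v
  exact (minSlope_eq_of_mem_face hj).trans_le (hj.2 i hi)

theorem mem_face_of_le_minSlope [Finite A] {a : A → E → ℝ} {S : Set A} {v : E → ℝ} {i : A}
    (hi : i ∈ S) (h : v ⬝ᵥ a i ≤ minSlope a S v) : i ∈ face a S v :=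
  ⟨hi, fun _ hj => h.trans (minSlope_le hj)⟩

theorem minSlope_anti [Finite A] (a : A → E → ℝ) {S T : Set A} (hST : S ⊆ T) (hS : S.Nonempty)
    (v : E → ℝ) : minSlope a T v ≤ minSlope a S v := by
  obtain ⟨j, hj⟩ := face_nonempty a hS v
  exact (minSlope_le (hST hj.1)).trans_eq (minSlope_eq_of_mem_face hj).symm

theorem face_smul (a : A → E → ℝ) (S : Set A) (v : E → ℝ) {c : ℝ} (hc : 0 < c) :
    face a S (c • v) = face a S v := by
  simp [face, hc]

theorem minSlope_smul [Finite A] (a : A → E → ℝ) {S : Set A} (hS : S.Nonempty) (v : E → ℝ) {c : ℝ}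
    (hc : 0 < c) : minSlope a S (c • v) = c * minSlope a S v := by
  obtain ⟨j, hj⟩ := face_nonempty a hS v
  rw [minSlope_eq_of_mem_face hj, minSlope_eq_of_mem_face ((face_smul a S v hc).symm ▸ hj),
    smul_dotProduct, smul_eq_mul]

theorem minSlope_face_self [Finite A] (a : A → E → ℝ) {S : Set A} (hS : S.Nonempty) (v : E → ℝ) :
    minSlope a (face a S v) v = minSlope a S v := by
  obtain ⟨j, hj⟩ := face_nonempty a hS v
  rw [minSlope_eq_of_mem_face hj, minSlope_eq_of_mem_face ⟨hj, fun l hl => hj.2 l hl.1⟩]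

theorem continuous_minSlope [Finite A] (a : A → E → ℝ) {S : Set A} (hS : S.Nonempty) :
    Continuous (minSlope a S) := by
  have hne : S.toFinite.toFinset.Nonempty := by simpa using hS
  have h : minSlope a S = fun v => S.toFinite.toFinset.inf' hne fun i => v ⬝ᵥ a i := by
    ext v
    obtain ⟨j, hj, hj'⟩ := Finset.exists_mem_eq_inf' hne fun i => v ⬝ᵥ a i
    rw [hj']
    refine minSlope_eq_of_mem_face ⟨by simpa using hj, fun l hl => ?_⟩
    rw [← hj']
    exact Finset.inf'_le (fun i => v ⬝ᵥ a i) (by simpa using hl)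
  rw [h]
  refine Continuous.finset_inf'_apply hne fun i _ => ?_
  unfold dotProduct
  fun_prop

theorem eventually_minSlope_eq [Finite A] (a : A → E → ℝ) {S : Set A} (hS : S.Nonempty)
    (p : E → ℝ) :
    ∀ᶠ q in 𝓝 p, minSlope a S q = minSlope a S p + minSlope a (face a S p) (q - p) := by
  filter_upwards [eventually_face_eq_face a S p] with q hq
  obtain ⟨i, hi⟩ := face_nonempty a hS q
  have hi' := hi
  rw [hq] at hi'
  rw [minSlope_eq_of_mem_face hi, minSlope_eq_of_mem_face hi', minSlope_eq_of_mem_face hi'.1,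
    sub_dotProduct]
  ring

/-- The right derivative of `minSlope` along a line. -/
theorem hasDerivWithinAt_minSlope [Finite A] (a : A → E → ℝ) {S : Set A} (hS : S.Nonempty)
    (x v : E → ℝ) (t : ℝ) :
    HasDerivWithinAt (fun s : ℝ => minSlope a S (x + s • v))
      (minSlope a (face a S (x + t • v)) v) (Ioi t) t := by
  set m := minSlope a (face a S (x + t • v)) v
  have hline : Tendsto (fun s : ℝ => x + s • v) (𝓝[>] t) (𝓝 (x + t • v)) :=
    (Continuous.tendsto (by fun_prop) t).mono_left nhdsWithin_le_nhds
  have hev : (fun s : ℝ => minSlope a S (x + s • v)) =ᶠ[𝓝[>] t]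
      fun s => minSlope a S (x + t • v) + (s - t) * m := by
    filter_upwards [hline.eventually (eventually_minSlope_eq a hS _), self_mem_nhdsWithin]
      with s hs hts
    rw [hs, ← minSlope_smul a (face_nonempty a hS _) v (sub_pos.2 hts)]
    congr 2
    rw [sub_smul]
    abel
  refine HasDerivWithinAt.congr_of_eventuallyEq ?_ hev (by simp)
  have h := (((hasDerivAt_id t).sub_const t).mul_const m).const_add (minSlope a S (x + t • v))
  simpa using h.hasDerivWithinAt

/-! ### Maps that locally pass to faces, and the integrals of their slopes. -/

/-- A map that near each point `p` sends `q` to the face of its value at `p` in direction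
`q - p`. -/
def IsLocallyFace (a : A → E → ℝ) (F : (E → ℝ) → Set A) : Prop :=
  ∀ p, ∀ᶠ q in 𝓝 p, F q = face a (F p) (q - p)

/-- The integral over a segment of the slopes given by `F`. -/
noncomputable def slopeIntegral (a : A → E → ℝ) (F : (E → ℝ) → Set A) (x y : E → ℝ) : ℝ :=
  ∫ t in (0 : ℝ)..1, minSlope a (F (x + t • (y - x))) (y - x)

namespace IsLocallyFace

variable {a : A → E → ℝ} {F : (E → ℝ) → Set A}

theorem isClosed_setOf_mem (hF : IsLocallyFace a F) (i : A) : IsClosed {q | i ∈ F q} := by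
  rw [← isOpen_compl_iff, isOpen_iff_mem_nhds]
  intro p hp
  filter_upwards [hF p] with q hq hi
  exact hp (face_subset a _ (q - p) (hq ▸ (show i ∈ F q from hi)))

/-- There are finitely many subconfigurations, and each fibre of `F` is cut out by the closed sets
where a given label occurs and their complements. -/
theorem measurable_comp [Finite A] (hF : IsLocallyFace a F) (f : Set A → ℝ) :
    Measurable fun q => f (F q) := by
  classical
  let _ : MeasurableSpace (Set A) := ⊤
  have : Measurable F := by
    refine measurable_to_countable' fun S => ?_
    have : F ⁻¹' {S} = ⋂ i, {q | i ∈ F q ↔ i ∈ S} := by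
      ext q
      simp [Set.ext_iff]
    rw [this]
    exact MeasurableSet.iInter fun i =>
      (measurableSet_setOfPred.1 (hF.isClosed_setOf_mem i).measurableSet).iff measurable_const
        |>.setOf
  exact (measurable_from_top (f := f)).comp this

theorem intervalIntegrable [Finite A] (hF : IsLocallyFace a F) (x v : E → ℝ) (s t : ℝ) :
    IntervalIntegrable (fun r : ℝ => minSlope a (F (x + r • v)) v) volume s t := by
  obtain ⟨C, hC⟩ := (Set.finite_range fun S : Set A => ‖minSlope a S v‖).bddAbove
  have hm : Measurable fun r : ℝ => minSlope a (F (x + r • v)) v :=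
    (hF.measurable_comp fun S => minSlope a S v).comp (by fun_prop)
  refine IntervalIntegrable.mono_fun (intervalIntegrable_const (c := C)) hm.aestronglyMeasurable
    (Eventually.of_forall fun r => ?_)
  exact (hC ⟨_, rfl⟩).trans (le_abs_self C)

theorem integral_eq_slopeIntegral [Finite A] (hne : ∀ p, (F p).Nonempty)
    (x v : E → ℝ) {s t : ℝ} (hst : s < t) :
    ∫ r in s..t, minSlope a (F (x + r • v)) v = slopeIntegral a F (x + s • v) (x + t • v) := by
  have h := intervalIntegral.mul_integral_comp_add_mul (a := 0) (b := 1)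
    (f := fun r : ℝ => minSlope a (F (x + r • v)) v) (t - s) s
  simp only [mul_zero, add_zero, mul_one, add_sub_cancel] at h
  rw [← h, slopeIntegral, ← intervalIntegral.integral_const_mul]
  congr 1
  ext r
  have e : x + t • v - (x + s • v) = (t - s) • v := by rw [sub_smul]; abel
  rw [e, minSlope_smul a (hne _) v (sub_pos.2 hst)]
  congr 3
  module

theorem slopeIntegral_midpoint [Finite A] (hF : IsLocallyFace a F) (hne : ∀ p, (F p).Nonempty)
    (x y : E → ℝ) :
    slopeIntegral a F x y =
      slopeIntegral a F x (midpoint ℝ x y) + slopeIntegral a F (midpoint ℝ x y) y := by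
  have hm : midpoint ℝ x y = x + (1 / 2 : ℝ) • (y - x) := by
    rw [midpoint_eq_smul_add, invOf_eq_inv]
    module
  have h0 := integral_eq_slopeIntegral (a := a) hne x (y - x) (show (0 : ℝ) < 1 / 2 by norm_num)
  have h1 := integral_eq_slopeIntegral (a := a) hne x (y - x) (show (1 / 2 : ℝ) < 1 by norm_num)
  rw [← hm] at h0 h1
  simp only [zero_smul, add_zero, one_smul, add_sub_cancel] at h0 h1
  rw [← h0, ← h1, intervalIntegral.integral_add_adjacent_intervals
    (hF.intervalIntegrable _ _ _ _) (hF.intervalIntegrable _ _ _ _), slopeIntegral]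

/-- Near `p` the slopes are those of the concave function `q ↦ minSlope a (F p) (q - p)`. -/
theorem slopeIntegral_eq_sub [Finite A] (hF : IsLocallyFace a F) (hne : ∀ p, (F p).Nonempty)
    {p : E → ℝ} {N : Set (E → ℝ)} (hN : Convex ℝ N) (hp : ∀ q ∈ N, F q = face a (F p) (q - p))
    {x y : E → ℝ} (hx : x ∈ N) (hy : y ∈ N) :
    slopeIntegral a F x y = minSlope a (F p) (y - p) - minSlope a (F p) (x - p) := by
  have h := intervalIntegral.integral_eq_sub_of_hasDeriv_right (a := 0) (b := 1)
    (f := fun s : ℝ => minSlope a (F p) (x - p + s • (y - x)))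
    (f' := fun t : ℝ => minSlope a (F (x + t • (y - x))) (y - x))
    ((continuous_minSlope a (hne p)).comp (by fun_prop)).continuousOn ?_
    (hF.intervalIntegrable _ _ _ _)
  · rw [slopeIntegral, h]
    simp
  · intro t ht
    simp only [zero_le_one, inf_of_le_left, sup_of_le_right] at ht
    have h := hasDerivWithinAt_minSlope a (hne p) (x - p) (y - x) t
    rwa [sub_add_eq_add_sub, ← hp _ (hN.add_smul_sub_mem hx hy ⟨ht.1.le, ht.2.le⟩)] at h

/-- This is Goursat's argument: on a small triangle the integral is a difference of values of a
local potential, and a large triangle is cut into four by its midpoints. -/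
theorem slopeIntegral_add [Finite A] (hF : IsLocallyFace a F) (hne : ∀ p, (F p).Nonempty)
    (x y z : E → ℝ) :
    slopeIntegral a F x y + slopeIntegral a F y z = slopeIntegral a F x z := by
  choose r hr hFr using fun p => Metric.eventually_nhds_iff_ball.1 (hF p)
  set K : Set (E → ℝ) := convexHull ℝ {x, y, z}
  have hK : IsCompact K := (Set.toFinite {x, y, z}).isCompact_convexHull (𝕜 := ℝ)
  have hKc : Convex ℝ K := convex_convexHull ℝ _
  obtain ⟨δ, hδ, hleb⟩ := lebesgue_number_lemma_of_metric hK
    (c := fun p => Metric.ball p (r p)) (fun _ => Metric.isOpen_ball)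
    (fun q _ => mem_iUnion.2 ⟨q, Metric.mem_ball_self (hr q)⟩)
  have hmid : ∀ {u v}, u ∈ K → v ∈ K → midpoint ℝ u v ∈ K := fun {u v} hu hv =>
    hKc.segment_subset hu hv (midpoint_mem_segment u v)
  have small : ∀ n : ℕ, ∀ x ∈ K, ∀ y ∈ K, ∀ z ∈ K, dist x y < 2 ^ n * δ → dist x z < 2 ^ n * δ →
      dist y z < 2 ^ n * δ →
      slopeIntegral a F x y + slopeIntegral a F y z = slopeIntegral a F x z := by
    intro n
    induction n with
    | zero =>
      intro x hx y hy z hz hxy hxz _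
      obtain ⟨p, hp⟩ := hleb x hx
      have key := fun {u v} => hF.slopeIntegral_eq_sub hne (convex_ball p (r p)) (hFr p)
        (x := u) (y := v)
      have hx' := hp (Metric.mem_ball_self hδ)
      have hy' := hp (show y ∈ Metric.ball x δ by simpa [dist_comm] using hxy)
      have hz' := hp (show z ∈ Metric.ball x δ by simpa [dist_comm] using hxz)
      rw [key hx' hy', key hy' hz', key hx' hz']
      ring
    | succ n ih =>
      intro x hx y hy z hz hxy hxz hyz
      have d1 : ∀ u v w : E → ℝ, dist v w < 2 ^ (n + 1) * δ →
          dist (midpoint ℝ u v) (midpoint ℝ u w) < 2 ^ n * δ := fun u v w h => by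
        have e : dist (midpoint ℝ u v) (midpoint ℝ u w) = dist v w / 2 := by
          rw [dist_eq_norm, dist_eq_norm, midpoint_eq_smul_add, midpoint_eq_smul_add, ← smul_sub,
            add_sub_add_left_eq_sub, norm_smul, invOf_eq_inv]
          norm_num
          ring
        rw [e]
        rw [pow_succ] at h
        linarith
      have d0 : ∀ u w : E → ℝ, dist u w < 2 ^ (n + 1) * δ →
          dist u (midpoint ℝ u w) < 2 ^ n * δ := fun u w h => by
        simpa using d1 u u w h
      have d2 : ∀ u w : E → ℝ, dist u w < 2 ^ (n + 1) * δ →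
          dist (midpoint ℝ u w) w < 2 ^ n * δ := fun u w h => by
        rw [dist_comm] at h ⊢
        simpa [midpoint_comm] using d0 w u h
      have d3 : ∀ u v w : E → ℝ, dist u w < 2 ^ (n + 1) * δ →
          dist (midpoint ℝ u v) (midpoint ℝ v w) < 2 ^ n * δ := fun u v w h => by
        simpa [midpoint_comm] using d1 v u w h
      have d4 : ∀ u v w : E → ℝ, dist u v < 2 ^ (n + 1) * δ →
          dist (midpoint ℝ u w) (midpoint ℝ v w) < 2 ^ n * δ := fun u v w h => by
        simpa [midpoint_comm] using d1 w u v h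
      -- `t1`, `t2`, `t3` are the corner triangles and `t4` the central one, oriented so that the
      -- inner edges cancel without reversing any segment.
      have hxy' := hmid hx hy
      have hxz' := hmid hx hz
      have hyz' := hmid hy hz
      have t1 := ih x hx _ hxy' _ hxz' (d0 _ _ hxy) (d0 _ _ hxz) (d1 _ _ _ hyz)
      have t2 := ih _ hxz' _ hyz' z hz (d4 _ _ _ hxy) (d2 _ _ hxz) (d2 _ _ hyz)
      have t3 := ih _ hxy' y hy _ hyz' (d2 _ _ hxy) (d3 _ _ _ hxz) (d0 _ _ hyz)
      have t4 := ih _ hxy' _ hxz' _ hyz' (d1 _ _ _ hyz) (d3 _ _ _ hxz) (d4 _ _ _ hxy)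
      have m1 := hF.slopeIntegral_midpoint hne x y
      have m2 := hF.slopeIntegral_midpoint hne y z
      have m3 := hF.slopeIntegral_midpoint hne x z
      linarith
  have hlim : ∀ᶠ n : ℕ in atTop, ∀ D ∈ ({dist x y, dist x z, dist y z} : Finset ℝ),
      D < 2 ^ n * δ := by
    refine (eventually_all_finset _).2 fun D _ => ?_
    exact ((tendsto_pow_atTop_atTop_of_one_lt one_lt_two).atTop_mul_const hδ).eventually_gt_atTop D
  obtain ⟨n, hn⟩ := hlim.exists
  exact small n x (subset_convexHull ℝ _ (by simp)) y (subset_convexHull ℝ _ (by simp)) z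
    (subset_convexHull ℝ _ (by simp)) (hn _ (by simp)) (hn _ (by simp)) (hn _ (by simp))

/-! ### Concavity along segments. -/

theorem eventually_right_eq_face (hF : IsLocallyFace a F) (x v : E → ℝ) (t : ℝ) :
    ∀ᶠ s in 𝓝[>] t, F (x + s • v) = face a (F (x + t • v)) v := by
  have hline : Tendsto (fun s : ℝ => x + s • v) (𝓝[>] t) (𝓝 (x + t • v)) :=
    (Continuous.tendsto (by fun_prop) t).mono_left nhdsWithin_le_nhds
  filter_upwards [hline.eventually (hF _), self_mem_nhdsWithin] with s hs hts
  have e : x + s • v - (x + t • v) = (s - t) • v := by module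
  rw [hs, e, face_smul a _ _ (sub_pos.2 hts)]

/-- The bound propagates from `0` along the segment. It holds on a closed set of parameters because
nearby values of `F` are subsets, which can only raise the slope; just to the right, `F` is the face
in direction `v`, which keeps the slope. -/
theorem minSlope_line_le [Finite A] (hF : IsLocallyFace a F) (hne : ∀ p, (F p).Nonempty)
    (x v : E → ℝ) {t : ℝ} (ht : t ∈ Icc (0 : ℝ) 1) :
    minSlope a (F (x + t • v)) v ≤ minSlope a (F x) v := by
  have hclosed : IsClosed {s : ℝ | minSlope a (F (x + s • v)) v ≤ minSlope a (F x) v} := by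
    rw [← isOpen_compl_iff, isOpen_iff_mem_nhds]
    intro s hs
    have hline : Tendsto (fun s : ℝ => x + s • v) (𝓝 s) (𝓝 (x + s • v)) :=
      Continuous.tendsto (by fun_prop) s
    filter_upwards [hline.eventually (hF _)] with r hr hle
    refine hs (le_trans (b := minSlope a (F (x + r • v)) v) ?_ hle)
    exact minSlope_anti a (hr ▸ face_subset a _ _) (hne _) v
  refine (hclosed.inter isClosed_Icc).Icc_subset_of_forall_mem_nhdsWithin (by simp) ?_ ht
  rintro s ⟨hs, _⟩
  filter_upwards [hF.eventually_right_eq_face x v s] with r hr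
  rw [hr, minSlope_face_self a (hne _)]
  exact hs

theorem slopeIntegral_le [Finite A] (hF : IsLocallyFace a F) (hne : ∀ p, (F p).Nonempty)
    (x y : E → ℝ) : slopeIntegral a F x y ≤ minSlope a (F x) (y - x) := by
  have h := intervalIntegral.integral_mono_on zero_le_one
    (hF.intervalIntegrable x (y - x) 0 1) (intervalIntegrable_const (c := minSlope a (F x) (y - x)))
    fun t ht => hF.minSlope_line_le hne x (y - x) ht
  simpa [slopeIntegral] using h

theorem slopeIntegral_le_of_mem [Finite A] (hF : IsLocallyFace a F) (hne : ∀ p, (F p).Nonempty)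
    {x : E → ℝ} {i : A} (hi : i ∈ F x) (y : E → ℝ) :
    slopeIntegral a F x y ≤ (y - x) ⬝ᵥ a i :=
  (hF.slopeIntegral_le hne x y).trans (minSlope_le hi)

/-- Equality forces `i` to persist along the whole segment: if `i ∈ F p`, the part before `p`
contributes at most the slope of `i`, so the rest must contribute at least that; hence `i` has
minimal slope in `F p` and survives just beyond `p`. -/
theorem mem_of_le_slopeIntegral [Finite A] (hF : IsLocallyFace a F) (hne : ∀ p, (F p).Nonempty)
    {x y : E → ℝ} {i : A} (hi : i ∈ F x) (h : (y - x) ⬝ᵥ a i ≤ slopeIntegral a F x y) :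
    i ∈ F y := by
  have hclosed : IsClosed {t : ℝ | i ∈ F (x + t • (y - x))} :=
    (hF.isClosed_setOf_mem i).preimage (f := fun t : ℝ => x + t • (y - x)) (by fun_prop)
  have h1 : (1 : ℝ) ∈ {t : ℝ | i ∈ F (x + t • (y - x))} := by
    refine (hclosed.inter isClosed_Icc).Icc_subset_of_forall_mem_nhdsWithin (a := 0)
      (by simpa using hi) ?_ (right_mem_Icc.2 zero_le_one)
    rintro t ⟨ht, _, ht1⟩
    filter_upwards [hF.eventually_right_eq_face x (y - x) t] with s hs
    rw [hs]
    set p := x + t • (y - x) with hp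
    have e1 : p - x = t • (y - x) := by rw [hp]; module
    have e2 : y - p = (1 - t) • (y - x) := by rw [hp]; module
    have hadd := hF.slopeIntegral_add hne x p y
    have hxp := hF.slopeIntegral_le_of_mem hne hi p
    have hpy := hF.slopeIntegral_le hne p y
    rw [e1, smul_dotProduct, smul_eq_mul] at hxp
    rw [e2, minSlope_smul a (hne p) _ (sub_pos.2 ht1)] at hpy
    refine mem_face_of_le_minSlope ht (le_of_mul_le_mul_left ?_ (sub_pos.2 ht1))
    linarith
  simpa using h1

/-! ### Reconstruction of the weight. -/

/-- A map to nonempty subconfigurations that locally passes to faces, and whose values minimize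
each linear form up to a constant, is given by a weight. -/
theorem exists_eq_coherentFace [Finite A] (hF : IsLocallyFace a F) (hne : ∀ p, (F p).Nonempty)
    (hbdd : ∀ j, ∃ C : ℝ, ∀ u, ∃ i ∈ F u, u ⬝ᵥ a i - u ⬝ᵥ a j ≤ C) :
    ∃ w : A → ℝ, ∀ u, coherentFace a w u = F u := by
  set h : (E → ℝ) → ℝ := slopeIntegral a F 0
  have hsub : ∀ x y, slopeIntegral a F x y = h y - h x := fun x y => by
    have := hF.slopeIntegral_add hne 0 x y
    simp only [h]
    linarith
  have hle : ∀ {x i}, i ∈ F x → ∀ y, h y - y ⬝ᵥ a i ≤ h x - x ⬝ᵥ a i := fun hi y => by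
    have := hF.slopeIntegral_le_of_mem hne hi y
    rw [hsub, sub_dotProduct] at this
    linarith
  have hmem : ∀ {x y i}, i ∈ F x → h x - x ⬝ᵥ a i ≤ h y - y ⬝ᵥ a i → i ∈ F y :=
    fun hi hxy => by
      refine hF.mem_of_le_slopeIntegral hne hi ?_
      rw [hsub, sub_dotProduct]
      linarith
  have hbound : ∃ M : ℝ, ∀ i u, i ∈ F u → h u - u ⬝ᵥ a i ≤ M := by
    have : ∀ i, ∃ M : ℝ, ∀ u, i ∈ F u → h u - u ⬝ᵥ a i ≤ M := fun i => by
      by_cases hi : ∃ x, i ∈ F x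
      · obtain ⟨x, hx⟩ := hi
        exact ⟨_, fun u _ => hle hx u⟩
      · exact ⟨0, fun u hu => absurd ⟨u, hu⟩ hi⟩
    choose M hM using this
    obtain ⟨B, hB⟩ := (Set.finite_range M).bddAbove
    exact ⟨B, fun i u hi => (hM i u hi).trans (hB ⟨i, rfl⟩)⟩
  have hw : ∀ j, ∃ c : ℝ, ∀ u, h u - u ⬝ᵥ a j ≤ c ∧ (c ≤ h u - u ⬝ᵥ a j ↔ j ∈ F u) := fun j => by
    by_cases hj : ∃ x, j ∈ F x
    · obtain ⟨x, hx⟩ := hj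
      exact ⟨_, fun u => ⟨hle hx u, hmem hx, fun hu => hle hu x⟩⟩
    · obtain ⟨M, hM⟩ := hbound
      obtain ⟨C, hC⟩ := hbdd j
      -- `M + C` bounds `h u - u ⬝ᵥ a j` through a label of `F u`; the extra `1` makes the
      -- inequality strict, so `j` is never a minimizer.
      refine ⟨M + C + 1, fun u => ?_⟩
      obtain ⟨i, hi, hiC⟩ := hC u
      have := hM i u hi
      exact ⟨by linarith, fun h' => by linarith, fun hu => absurd ⟨u, hu⟩ hj⟩
  choose w hw using hw
  refine ⟨w, fun u => Set.ext fun j => ⟨fun hj => ?_, fun hj i => ?_⟩⟩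
  · obtain ⟨i, hi⟩ := hne u
    refine ((hw j u).2).1 ?_
    have h1 := ((hw i u).2).2 hi
    have h2 := hj i
    linarith
  · have h1 := ((hw j u).2).2 hj
    have h2 := (hw i u).1
    linarith

end IsLocallyFace

/-! ### Products of faces and Minkowski sums. -/

section MinkowskiSum

variable {k : ℕ} {A : Fin k → Type*} (a : ∀ i, A i → E → ℝ)

theorem dotProduct_minkowskiSum (u : E → ℝ) (j : ∀ i, A i) :
    u ⬝ᵥ minkowskiSum a j = ∑ i, u ⬝ᵥ a i (j i) :=
  dotProduct_sum _ _ _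

theorem sum_update_add [DecidableEq (Fin k)] (c : ∀ i, A i → ℝ) (j : ∀ i, A i) (i : Fin k)
    (y : A i) : ∑ m, c m (Function.update j i y m) + c i (j i) = ∑ m, c m (j m) + c i y := by
  have h : ∑ m ∈ Finset.univ.erase i, c m (Function.update j i y m) =
      ∑ m ∈ Finset.univ.erase i, c m (j m) := Finset.sum_congr rfl fun m hm => by
    rw [Function.update_of_ne (Finset.ne_of_mem_erase hm)]
  rw [← Finset.add_sum_erase _ _ (Finset.mem_univ i), h,
    ← Finset.add_sum_erase _ (fun m => c m (j m)) (Finset.mem_univ i), Function.update_self]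
  ring

theorem setOf_sum_le_eq_pi {c : ∀ i, A i → ℝ} {G : ∀ i, Set (A i)} :
    {j : ∀ i, A i | j ∈ pi univ G ∧ ∀ l ∈ pi univ G, ∑ i, c i (j i) ≤ ∑ i, c i (l i)} =
      pi univ fun i => {x | x ∈ G i ∧ ∀ y ∈ G i, c i x ≤ c i y} := by
  classical
  ext j
  constructor
  · rintro ⟨hj, hmin⟩ i -
    refine ⟨hj i trivial, fun y hy => ?_⟩
    have hl : Function.update j i y ∈ pi univ G := fun m _ => by
      by_cases hm : m = i
      · subst hm
        simpa using hy
      · simpa [hm] using hj m trivial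
    have h := hmin _ hl
    have := sum_update_add c j i y
    linarith
  · intro hj
    exact ⟨fun i _ => (hj i trivial).1, fun l hl =>
      Finset.sum_le_sum fun i _ => (hj i trivial).2 _ (hl i trivial)⟩

theorem face_minkowskiSum_pi (G : ∀ i, Set (A i)) (u : E → ℝ) :
    face (minkowskiSum a) (pi univ G) u = pi univ fun i => face (a i) (G i) u := by
  simp only [face, dotProduct_minkowskiSum]
  exact setOf_sum_le_eq_pi (c := fun i x => u ⬝ᵥ a i x)

theorem coherentFace_weightSum (v : ∀ i, A i → ℝ) (u : E → ℝ) :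
    coherentFace (minkowskiSum a) (weightSum v) u =
      pi univ fun i => coherentFace (a i) (v i) u := by
  have h := setOf_sum_le_eq_pi (c := fun i x => u ⬝ᵥ a i x + v i x) (G := fun _ => univ)
  simpa [coherentFace, dotProduct_minkowskiSum, weightSum, Finset.sum_add_distrib] using h

theorem pi_univ_injOn_nonempty {G H : ∀ i, Set (A i)} (hG : (pi univ G).Nonempty)
    (h : pi univ G = pi univ H) : G = H := by
  funext i
  rw [← eval_image_univ_pi (i := i) hG, h, eval_image_univ_pi (h ▸ hG)]

/-- If the cells of a coherent subdivision of a Minkowski sum are products, then it is induced by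
a Minkowski sum of weights. -/
theorem exists_weightSum_coherentFace_eq [∀ i, Finite (A i)] [∀ i, Nonempty (A i)]
    (w : (∀ i, A i) → ℝ) (G : (E → ℝ) → ∀ i, Set (A i))
    (hG : ∀ u, coherentFace (minkowskiSum a) w u = pi univ (G u)) :
    ∃ v : ∀ i, A i → ℝ, ∀ u,
      coherentFace (minkowskiSum a) (weightSum v) u = coherentFace (minkowskiSum a) w u := by
  classical
  have hpi : ∀ u, (pi univ (G u)).Nonempty := fun u => hG u ▸ coherentFace_nonempty _ w u
  have hne : ∀ i u, (G u i).Nonempty := fun i u => univ_pi_nonempty_iff.1 (hpi u) i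
  have hloc : ∀ i, IsLocallyFace (a i) fun u => G u i := fun i p => by
    filter_upwards [eventually_coherentFace_eq_face (minkowskiSum a) w p] with q hq
    rw [hG, hG, face_minkowskiSum_pi] at hq
    exact congrFun (pi_univ_injOn_nonempty (hpi q) hq) i
  obtain ⟨B, hB⟩ := (Set.finite_range fun x : (∀ i, A i) × (∀ i, A i) => w x.1 - w x.2).bddAbove
  have hbdd : ∀ i y, ∃ C : ℝ, ∀ u, ∃ x ∈ G u i, u ⬝ᵥ a i x - u ⬝ᵥ a i y ≤ C := fun i y => by
    refine ⟨B, fun u => ?_⟩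
    obtain ⟨j, hj⟩ := hpi u
    refine ⟨j i, hj i trivial, ?_⟩
    have h : j ∈ coherentFace (minkowskiSum a) w u := hG u ▸ hj
    -- Changing only the `i`-th label of a minimizer compares `j i` with `y`, at a cost bounded by
    -- the oscillation of `w`.
    have h := h (Function.update j i y)
    have hw : w (Function.update j i y) - w j ≤ B := hB ⟨(_, _), rfl⟩
    have := sum_update_add (fun m x => u ⬝ᵥ a m x) j i y
    rw [dotProduct_minkowskiSum, dotProduct_minkowskiSum] at h
    linarith
  choose v hv using fun i => (hloc i).exists_eq_coherentFace (hne i) (hbdd i)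
  refine ⟨v, fun u => ?_⟩
  rw [coherentFace_weightSum, hG]
  simp only [hv]

end MinkowskiSum

end PointConfiguration

theorem mainTheorem6 {E : Type*} [Fintype E] {k : ℕ} {A : Fin k → Type*} [∀ i, Finite (A i)]
    (a : ∀ i, A i → E → ℝ)
    (hint : ∀ i, PointConfiguration.Integral (a i))
    (hhom : ∀ i, PointConfiguration.Homogeneous (a i))
    (hdim : ∀ i, PointConfiguration.dim (a i) = 1 → Nat.card (A i) = 2)
    (w : (∀ i, A i) → ℝ)
    (hmixed : PointConfiguration.IsMixed a
      (PointConfiguration.coherentSubdivision (PointConfiguration.minkowskiSum a) w)) :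
    ∃ v : ∀ i, A i → ℝ,
      PointConfiguration.coherentSubdivision (PointConfiguration.minkowskiSum a)
          (PointConfiguration.weightSum v) =
        PointConfiguration.coherentSubdivision (PointConfiguration.minkowskiSum a) w := by
  choose G _ hG using hmixed.choose_spec.2
  rcases isEmpty_or_nonempty (∀ i, A i) with hA | hA
  -- With no labels in the sum every cell is empty, so any weights do.
  · refine ⟨fun _ _ => 0, congrArg Set.range (funext fun u => ?_)⟩
    exact Set.eq_empty_of_isEmpty _ |>.trans (Set.eq_empty_of_isEmpty _).symm
  · have hA' : ∀ i, Nonempty (A i) := fun i => hA.map fun j => j i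
    obtain ⟨v, hv⟩ := PointConfiguration.exists_weightSum_coherentFace_eq a w
      (fun u => G _ ⟨u, rfl⟩) fun u => hG _ ⟨u, rfl⟩
    exact ⟨v, congrArg Set.range (funext hv)⟩
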